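/- For integers $r,s\ge 1$ and $n\ge 0$, let $a_{r,s}(n)$ denote the number of partitions of $n$ in which each even part may appear in one of $r$ colors and each odd part may appear in one of $s$ colors (with $a_{r,s}(0)=1$). Then for all integers $n\ge 0$ and all integers $k\ge j\ge 0$, $$a_{9(k-j)+5,\;9k+1}(9n+6)\equiv 0 \pmod 3.$$ -/

import Mathlib

/-- A partition of `n` in which every even part carries one of `r` colors and every odd part
carries one of `s` colors: a finite multiset of colored parts `(m, c)`, where `m` is the size of
the part and `c` its color (numbered from `0`), whose sizes add up to `n`. -/
structure ColoredPartition (r s n : ℕ) where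
  /-- the colored parts `(m, c)`, counted with multiplicity and without order -/
  parts : Multiset (ℕ × ℕ)
  parts_pos : ∀ x ∈ parts, 0 < x.1
  color_lt : ∀ x ∈ parts, x.2 < if Even x.1 then r else s
  sum_parts : (parts.map Prod.fst).sum = n

theorem ColoredPartition.parts_injective (r s n : ℕ) :
    Function.Injective (ColoredPartition.parts : ColoredPartition r s n → Multiset (ℕ × ℕ)) := by
  rintro ⟨p, _, _, _⟩ ⟨q, _, _, _⟩ h
  cases h
  rfl

/-- There are only finitely many colored partitions of `n`, so that counting them with `Nat.card`
is meaningful. -/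
instance ColoredPartition.instFinite (r s n : ℕ) : Finite (ColoredPartition r s n) := by
  let B : Multiset (ℕ × ℕ) := n • (Finset.range (n + 1) ×ˢ Finset.range (r + s)).val
  have hB : ∀ p : ColoredPartition r s n, p.parts ∈ Set.Iic B := by
    intro p
    have hcard : p.parts.card ≤ n := by
      have h := Multiset.card_nsmul_le_sum (s := p.parts.map Prod.fst) (a := 1) (by
        intro m hm
        obtain ⟨x, hx, rfl⟩ := Multiset.mem_map.1 hm
        exact p.parts_pos x hx)
      simpa [p.sum_parts] using h
    refine Multiset.le_iff_count.2 fun x => ?_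
    by_cases hx : x ∈ p.parts
    · have h1 : x.1 ≤ n := by
        have h := Multiset.single_le_sum (fun _ _ => Nat.zero_le _) x.1
          (Multiset.mem_map_of_mem Prod.fst hx)
        rwa [p.sum_parts] at h
      have h2 : x.2 < r + s := by
        have h := p.color_lt x hx
        split_ifs at h <;> omega
      have hmem : x ∈ Finset.range (n + 1) ×ˢ Finset.range (r + s) := by
        simp only [Finset.mem_product, Finset.mem_range]
        omega
      have hone : 1 ≤ Multiset.count x (Finset.range (n + 1) ×ˢ Finset.range (r + s)).val :=
        Multiset.one_le_count_iff_mem.2 hmem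
      calc Multiset.count x p.parts ≤ n := (Multiset.count_le_card _ _).trans hcard
        _ ≤ n * Multiset.count x (Finset.range (n + 1) ×ˢ Finset.range (r + s)).val :=
          Nat.le_mul_of_pos_right n hone
        _ = Multiset.count x B := (Multiset.count_nsmul _ _ _).symm
    · rw [Multiset.count_eq_zero_of_notMem hx]
      exact Nat.zero_le _
  have hfin : (Set.Iic B).Finite := Set.finite_Iic B
  have := hfin.to_subtype
  exact Finite.of_injective (fun p : ColoredPartition r s n => (⟨p.parts, hB p⟩ : Set.Iic B))
    fun p q h => ColoredPartition.parts_injective r s n (congrArg Subtype.val h)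

/-- `coloredPartitionCount r s n` is `a_{r,s}(n)`, the number of partitions of `n` with
`r`-colored even parts and `s`-colored odd parts. -/
noncomputable def coloredPartitionCount (r s n : ℕ) : ℕ :=
  Nat.card (ColoredPartition r s n)

/-!
Write `f_m = ∏_{i ≥ 1} (1 - q^{mi})`. The generating function of `a_{r,s}` is
`f_2^s / (f_1^s f_2^r)` (`mk_coloredPartitionCount_mul`). Modulo `3`, raising to the ninth power
agrees with substituting `q^9` for `q`, so for `r = 9(k-j)+5` and `s = 9k+1` the generating function
is a power series in `q^9` times `f_2^5 / f_1`. By Gauss's identity `f_2^2 / f_1 = ψ(q)`, where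
`ψ(q) = ∑_{k ≥ 0} q^{k(k+1)/2}` (`triangularSeries_mul_pentagonalSeries`), and `f_2^3 ≡ f_6`; hence
it suffices that `f_6 ψ` has no terms with exponent `≡ 6 (mod 9)`.

This holds in every field (`coeff_expand_six_mul_triangularSeries`). The triangular
numbers divisible by `3` are the numbers `3 p(v)` with `p(v) = v(3v-1)/2` and `v ∈ ℤ`, so by the
pentagonal number theorem the coefficient of `q^{9n+6}` in `f_6 ψ` is the sum of `(-1)^u` over all
`(u, v) ∈ ℤ²` with `2 p(u) + p(v) = 3n + 2`. With `b = 6u - 1` and `a = 6v - 1` this equation reads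
`a² + 2b² = 72n + 51`. There `a + b√-2 = (c + d√-2)(1 + √-2)` with `3 ∣ c`, and the
substitution `c ↦ -c` is an involution on the solutions which reverses the sign `(-1)^u`
(`sum_negOnePow_eq_zero`).
-/

open Filter PowerSeries PowerSeries.WithPiTopology Topology

/-! ### Multisets of given weight with elements in a finite set -/

/-- The multisets with elements in `S` whose weights, with multiplicity, add up to `n`. -/
def multisetsOfWeight {α : Type*} (w : α → ℕ) (S : Finset α) (n : ℕ) : Set (Multiset α) :=
  {p | (∀ x ∈ p, x ∈ S) ∧ (p.map w).sum = n}

theorem multisetsOfWeight_finite {α : Type*} {w : α → ℕ} {S : Finset α}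
    (hw : ∀ x ∈ S, 0 < w x) (n : ℕ) : (multisetsOfWeight w S n).Finite := by
  classical
  refine (Set.finite_Iic (n • S.val)).subset fun p hp => Multiset.le_iff_count.2 fun x => ?_
  by_cases hx : x ∈ p
  · have hcard : p.card ≤ n := by
      have h := Multiset.card_nsmul_le_sum (s := p.map w) (a := 1) (by
        intro m hm
        obtain ⟨x, hx, rfl⟩ := Multiset.mem_map.1 hm
        exact hw x (hp.1 x hx))
      simpa [hp.2] using h
    rw [Multiset.count_nsmul, Multiset.count_eq_one_of_mem S.nodup (hp.1 x hx), mul_one]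
    exact (Multiset.count_le_card _ _).trans hcard
  · simp [hx]

/-- A multiset with elements in `insert a S` either avoids `a`, or arises by adding one copy of `a`
to another such multiset. -/
theorem ncard_multisetsOfWeight_insert {α : Type*} [DecidableEq α] {w : α → ℕ} {S : Finset α}
    {a : α} (ha : a ∉ S) (hw : ∀ x ∈ insert a S, 0 < w x) (n : ℕ) :
    (multisetsOfWeight w (insert a S) n).ncard = (multisetsOfWeight w S n).ncard +
      if w a ≤ n then (multisetsOfWeight w (insert a S) (n - w a)).ncard else 0 := by
  have hfin := fun m => multisetsOfWeight_finite hw m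
  have hfin' := fun m =>
    multisetsOfWeight_finite (fun x hx => hw x (Finset.mem_insert_of_mem hx)) m
  split_ifs with h
  · rw [← Set.ncard_image_of_injective (multisetsOfWeight w (insert a S) (n - w a))
      (f := fun p => a ::ₘ p) (fun p q h => by simpa using h), ← Set.ncard_union_eq _ (hfin' _)
      ((hfin _).image _)]
    · congr 1
      ext p
      simp only [multisetsOfWeight, Set.mem_ofPred_eq, Set.mem_union, Set.mem_image,
        Finset.mem_insert]
      constructor
      · rintro ⟨h1, h2⟩
        by_cases hp : a ∈ p
        · obtain ⟨q, rfl⟩ := Multiset.exists_cons_of_mem hp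
          refine Or.inr ⟨q, ⟨fun x hx => h1 x (Multiset.mem_cons_of_mem hx), ?_⟩, rfl⟩
          simp at h2
          omega
        · refine Or.inl ⟨fun x hx => (h1 x hx).resolve_left ?_, h2⟩
          rintro rfl
          exact hp hx
      · rintro (⟨h1, h2⟩ | ⟨q, ⟨h1, h2⟩, rfl⟩)
        · exact ⟨fun x hx => Or.inr (h1 x hx), h2⟩
        · refine ⟨fun x hx => ?_, by simp; omega⟩
          rcases Multiset.mem_cons.1 hx with rfl | hx
          · exact Or.inl rfl
          · exact h1 x hx
    · rw [Set.disjoint_left]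
      rintro _ hp ⟨q, -, rfl⟩
      exact ha (hp.1 a (Multiset.mem_cons_self _ _))
  · rw [add_zero]
    congr 1
    ext p
    simp only [multisetsOfWeight, Set.mem_ofPred_eq, Finset.mem_insert]
    refine ⟨fun ⟨h1, h2⟩ => ⟨fun x hx => (h1 x hx).resolve_left ?_, h2⟩,
      fun ⟨h1, h2⟩ => ⟨fun x hx => Or.inr (h1 x hx), h2⟩⟩
    rintro rfl
    exact h (h2 ▸ Multiset.single_le_sum (fun _ _ => Nat.zero_le _) _
      (Multiset.mem_map_of_mem w hx))

/-- The generating function of multisets with elements in `S` is `∏ x ∈ S, 1 / (1 - X ^ w x)`. -/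
theorem mk_ncard_multisetsOfWeight_mul_prod (R : Type*) [CommRing R] {α : Type*} {w : α → ℕ}
    (S : Finset α) (hw : ∀ x ∈ S, 0 < w x) :
    (PowerSeries.mk fun n => ((multisetsOfWeight w S n).ncard : R)) *
      ∏ x ∈ S, (1 - X ^ w x) = 1 := by
  classical
  induction S using Finset.induction_on with
  | empty =>
    ext n
    have : multisetsOfWeight w ∅ n = if n = 0 then {0} else ∅ := by
      ext p
      split_ifs with h
      · simp only [multisetsOfWeight, Finset.notMem_empty, Set.mem_ofPred_eq,
          Set.mem_singleton_iff, ← Multiset.eq_zero_iff_forall_notMem]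
        refine ⟨fun h => h.1, ?_⟩
        rintro rfl
        simp [h]
      · simp only [multisetsOfWeight, Finset.notMem_empty, Set.mem_ofPred_eq,
          Set.mem_empty_iff_false, iff_false, ← Multiset.eq_zero_iff_forall_notMem]
        rintro ⟨rfl, h2⟩
        exact h (by simpa using h2.symm)
    rw [Finset.prod_empty, mul_one, coeff_mk, this, coeff_one]
    split_ifs <;> simp
  | insert a S ha ih =>
    have ih := ih fun x hx => hw x (Finset.mem_insert_of_mem hx)
    rw [Finset.prod_insert ha, ← mul_assoc]
    refine Eq.trans (congrArg (· * _) ?_) ih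
    ext n
    rw [mul_sub, mul_one, map_sub, coeff_mul_X_pow', coeff_mk, coeff_mk, coeff_mk,
      ncard_multisetsOfWeight_insert ha hw]
    split_ifs <;> simp

/-! ### The generating function of colored partitions -/

/-- The product of `1 - X ^ m` over the first `n` odd numbers `m`. -/
noncomputable def oddProd (R : Type*) [CommRing R] (n : ℕ) : R⟦X⟧ :=
  ∏ i ∈ Finset.range n, (1 - X ^ (2 * i + 1))

/-- The product of `1 - X ^ m` over the first `n` positive even numbers `m`. -/
noncomputable def evenProd (R : Type*) [CommRing R] (n : ℕ) : R⟦X⟧ :=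
  ∏ i ∈ Finset.range n, (1 - X ^ (2 * i + 2))

/-- The colored parts `(m, c)` of size `1 ≤ m ≤ 2 * n`. The bound is even so that there are equally
many even and odd sizes. -/
def coloredParts (r s n : ℕ) : Finset (ℕ × ℕ) :=
  (Finset.Icc 1 (2 * n) ×ˢ Finset.range (r + s)).filter fun x => x.2 < if Even x.1 then r else s

theorem mem_coloredParts {r s n : ℕ} {x : ℕ × ℕ} :
    x ∈ coloredParts r s n ↔
      x.1 ∈ Finset.Icc 1 (2 * n) ∧ x.2 ∈ Finset.range (if Even x.1 then r else s) := by
  simp only [coloredParts, Finset.mem_filter, Finset.mem_product, Finset.mem_range]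
  split_ifs <;> constructor <;> rintro h <;> refine ⟨?_, ?_⟩ <;> grind

theorem prod_coloredParts (R : Type*) [CommRing R] (r s n : ℕ) :
    ∏ x ∈ coloredParts r s n, (1 - X ^ x.1 : R⟦X⟧) = oddProd R n ^ s * evenProd R n ^ r := by
  rw [Finset.prod_finset_product _ (Finset.Icc 1 (2 * n))
    (fun m => Finset.range (if Even m then r else s)) fun x => mem_coloredParts]
  simp only [Finset.prod_const, Finset.card_range]
  induction n with
  | zero => simp [oddProd, evenProd]
  | succ n ih =>
    rw [mul_add_one, Finset.prod_Icc_succ_top (by omega), Finset.prod_Icc_succ_top (by omega), ih,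
      oddProd, evenProd, oddProd, evenProd, Finset.prod_range_succ, Finset.prod_range_succ,
      if_neg (by simp), if_pos (by grind), mul_pow, mul_pow]
    ring

theorem coloredPartitionCount_eq_ncard {r s m n : ℕ} (h : m ≤ 2 * n) :
    coloredPartitionCount r s m = (multisetsOfWeight Prod.fst (coloredParts r s n) m).ncard := by
  rw [coloredPartitionCount, ← Nat.card_coe_set_eq]
  refine Nat.card_congr
    { toFun := fun p => ⟨p.parts, fun x hx => ?_, p.sum_parts⟩
      invFun := fun p => ⟨p.1, fun x hx => ?_, fun x hx => ?_, p.2.2⟩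
      left_inv := fun p => rfl
      right_inv := fun p => rfl }
  · rw [mem_coloredParts, Finset.mem_Icc, Finset.mem_range]
    have h1 := Multiset.single_le_sum (fun _ _ => Nat.zero_le _) x.1
          (Multiset.mem_map_of_mem Prod.fst hx)
    rw [p.sum_parts] at h1
    exact ⟨⟨p.parts_pos x hx, by omega⟩, p.color_lt x hx⟩
  · have := (mem_coloredParts.1 (p.2.1 x hx)).1
    simp at this
    omega
  · simpa using (mem_coloredParts.1 (p.2.1 x hx)).2

section Limits

variable (R : Type*) [CommRing R] [TopologicalSpace R]

theorem tendsto_evenProd :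
    Tendsto (evenProd R) atTop (𝓝 (expand 2 two_ne_zero (pentagonalSeries R))) := by
  have h : ∀ n, evenProd R n =
      expand 2 two_ne_zero (∏ i ∈ Finset.range n, (1 - X ^ (i + 1) : R⟦X⟧)) := by
    intro n
    simp only [evenProd, map_prod, map_sub, map_one, map_pow, expand_X, ← pow_mul, mul_add_one]
  rw [tendsto_iff_coeff_tendsto]
  intro d
  refine tendsto_nhds_of_eventually_eq ?_
  have h1 := tendsto_finset_range.eventually (coeff_prod_one_sub_X_pow_eventually_eq R (d / 2))
  filter_upwards [h1] with n hn
  rw [h, coeff_expand, coeff_expand, hn]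

theorem tendsto_oddProd_mul_evenProd :
    Tendsto (fun n => oddProd R n * evenProd R n) atTop (𝓝 (pentagonalSeries R)) := by
  have h : ∀ n, oddProd R n * evenProd R n =
      ∏ i ∈ Finset.range (2 * n), (1 - X ^ (i + 1) : R⟦X⟧) := by
    intro n
    induction n with
    | zero => simp [oddProd, evenProd]
    | succ n ih =>
      rw [mul_add_one, Finset.prod_range_succ, Finset.prod_range_succ, ← ih, oddProd, evenProd,
        oddProd, evenProd, Finset.prod_range_succ, Finset.prod_range_succ]
      ring
  simp only [h]
  exact ((hasProd_one_sub_X_pow R).comp tendsto_finset_range).comp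
    (tendsto_id.const_mul_atTop' two_pos)

end Limits

/-- The generating function of `a_{r,s}` is `f_2 ^ s / (f_1 ^ s * f_2 ^ r)`, where `f_1` is the Euler
product `pentagonalSeries` and `f_2` is `f_1` at `X ^ 2`. -/
theorem mk_coloredPartitionCount_mul (R : Type*) [CommRing R] (r s : ℕ) :
    (PowerSeries.mk fun n => (coloredPartitionCount r s n : R)) * pentagonalSeries R ^ s *
      expand 2 two_ne_zero (pentagonalSeries R) ^ r =
    expand 2 two_ne_zero (pentagonalSeries R) ^ s := by
  let : TopologicalSpace R := ⊥
  have : DiscreteTopology R := ⟨rfl⟩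
  have hG : Tendsto (fun N => PowerSeries.mk fun n =>
      ((multisetsOfWeight Prod.fst (coloredParts r s N) n).ncard : R)) atTop
      (𝓝 (PowerSeries.mk fun n => (coloredPartitionCount r s n : R))) := by
    rw [tendsto_iff_coeff_tendsto]
    intro d
    refine tendsto_nhds_of_eventually_eq ?_
    filter_upwards [eventually_ge_atTop d] with N hN
    rw [coeff_mk, coeff_mk, coloredPartitionCount_eq_ncard (n := N) (by omega)]
  have hE := tendsto_evenProd R
  have hO := tendsto_oddProd_mul_evenProd R
  refine tendsto_nhds_unique ((hG.mul (hO.pow s)).mul (hE.pow r)) ((hE.pow s).congr fun N => ?_)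
  have h := mk_ncard_multisetsOfWeight_mul_prod R (w := Prod.fst) (coloredParts r s N)
    fun x hx => by
      have := (mem_coloredParts.1 hx).1
      simp at this
      omega
  rw [prod_coloredParts] at h
  linear_combination -evenProd R N ^ s * h

/-! ### Gauss's identity for triangular numbers -/

/-- The partial product `∏ i < n, (1 - X ^ (2 * i + 2)) / (1 - X ^ (2 * i + 1))`. -/
noncomputable def evenOddQuotient (K : Type*) [Field K] (n : ℕ) : K⟦X⟧ :=
  evenProd K n * (oddProd K n)⁻¹

section Gauss
variable (K : Type*) [Field K]

theorem constantCoeff_oddProd (n : ℕ) : constantCoeff (oddProd K n) = 1 := by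
  simp [oddProd, map_prod]

theorem constantCoeff_evenProd (n : ℕ) : constantCoeff (evenProd K n) = 1 := by
  simp [evenProd, map_prod]

theorem evenOddQuotient_ne_zero (n : ℕ) : constantCoeff (evenOddQuotient K n) ≠ 0 := by
  simp [evenOddQuotient, constantCoeff_oddProd, constantCoeff_evenProd]

theorem evenOddQuotient_succ_mul (n : ℕ) :
    evenOddQuotient K (n + 1) * (1 - X ^ (2 * n + 1)) =
      evenOddQuotient K n * (1 - X ^ (2 * n + 2)) := by
  have h (m) : oddProd K m * (oddProd K m)⁻¹ = 1 :=
    PowerSeries.mul_inv_cancel _ (by simp [constantCoeff_oddProd])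
  have h1 := h (n + 1)
  have h0 := h n
  rw [evenOddQuotient, evenOddQuotient, evenProd, Finset.prod_range_succ, ← evenProd]
  rw [show oddProd K (n + 1) = oddProd K n * (1 - X ^ (2 * n + 1)) from
    Finset.prod_range_succ _ _] at h1 ⊢
  linear_combination (exp := 1) (evenProd K n * (1 - X ^ (2 * n + 2)) * (oddProd K n)⁻¹) * h1 -
    (evenProd K n * (1 - X ^ (2 * n + 2)) * (1 - X ^ (2 * n + 1)) *
      (oddProd K n * (1 - X ^ (2 * n + 1)))⁻¹) * h0

/-- Shanks's finite form of Gauss's identity. With `P` for `evenOddQuotient`, the terms of the right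
side satisfy a recursion in `n` up to a difference that telescopes in `s`. -/
theorem sum_triangular_eq (n : ℕ) :
    ∑ k ∈ Finset.range (2 * n + 1), (X : K⟦X⟧) ^ (k * (k + 1) / 2) =
      ∑ s ∈ Finset.range (n + 1),
        evenOddQuotient K n * (evenOddQuotient K s)⁻¹ * X ^ (s * (2 * n + 1)) := by
  set P := evenOddQuotient K with hP
  have hinv (m) : P m * (P m)⁻¹ = 1 := PowerSeries.mul_inv_cancel _ (evenOddQuotient_ne_zero K m)
  have hinvs (s) : (P (s + 1))⁻¹ * (1 - X ^ (2 * s + 2)) = (P s)⁻¹ * (1 - X ^ (2 * s + 1)) := by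
    linear_combination (P (s + 1))⁻¹ * (P s)⁻¹ * -evenOddQuotient_succ_mul K s
      - (P (s + 1))⁻¹ * (1 - X ^ (2 * s + 2)) * hinv s
      + (P s)⁻¹ * (1 - X ^ (2 * s + 1)) * hinv (s + 1)
  induction n with
  | zero => simp [hinv]
  | succ n ih =>
    have hne : (1 - X ^ (2 * n + 1) : K⟦X⟧) ≠ 0 := fun h => by
      simpa using congrArg constantCoeff h
    -- Each summand times `1 - X ^ (2 * n + 1)` is the difference of consecutive right-hand sides,
    -- and the right-hand side vanishes at `m = 0`.
    have key : ∀ m, (1 - X ^ (2 * n + 1)) * ∑ s ∈ Finset.range m,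
        (P (n + 1) * (P s)⁻¹ * X ^ (s * (2 * (n + 1) + 1)) - P n * (P s)⁻¹ * X ^ (s * (2 * n + 1)))
        = P n * X ^ (m * (2 * n + 1)) * (1 - X ^ (2 * m)) * (P m)⁻¹ := by
      intro m
      induction m with
      | zero => simp
      | succ m ihm =>
        rw [Finset.sum_range_succ, mul_add, ihm]
        linear_combination (P m)⁻¹ * X ^ (m * (2 * (n + 1) + 1)) * evenOddQuotient_succ_mul K n
          - P n * X ^ ((m + 1) * (2 * n + 1)) * hinvs m
    have hsum : ∑ s ∈ Finset.range (n + 1), (P (n + 1) * (P s)⁻¹ * X ^ (s * (2 * (n + 1) + 1)) -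
        P n * (P s)⁻¹ * X ^ (s * (2 * n + 1))) = X ^ ((n + 1) * (2 * n + 1)) := by
      refine mul_left_cancel₀ hne ?_
      rw [key]
      linear_combination P n * X ^ ((n + 1) * (2 * n + 1)) * hinvs n +
        X ^ ((n + 1) * (2 * n + 1)) * (1 - X ^ (2 * n + 1)) * hinv n
    rw [Finset.sum_sub_distrib, ← ih] at hsum
    rw [Finset.sum_range_succ _ (n + 1), hinv, mul_add_one, Finset.sum_range_succ,
      Finset.sum_range_succ,
      show (2 * n + 1) * (2 * n + 1 + 1) / 2 = (n + 1) * (2 * n + 1) by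
        rw [show (2 * n + 1) * (2 * n + 1 + 1) = 2 * ((n + 1) * (2 * n + 1)) by ring]; simp,
      show (2 * n + 2) * (2 * n + 2 + 1) / 2 = (n + 1) * (2 * (n + 1) + 1) by
        rw [show (2 * n + 2) * (2 * n + 2 + 1) = 2 * ((n + 1) * (2 * (n + 1) + 1)) by ring]; simp]
    linear_combination -hsum

open Classical in
/-- The theta series `ψ = ∑ k, X ^ (k * (k + 1) / 2)`, given by its coefficients. -/
noncomputable def triangularSeries : K⟦X⟧ :=
  .mk fun n => if ∃ k, k * (k + 1) / 2 = n then 1 else 0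

theorem triangular_strictMono : StrictMono fun k : ℕ => k * (k + 1) / 2 := by
  refine strictMono_nat_of_lt_succ fun k => ?_
  rw [show (k + 1) * (k + 1 + 1) = k * (k + 1) + (k + 1) * 2 by ring,
    Nat.add_mul_div_right _ _ two_pos]
  omega

theorem tendsto_sum_triangular [TopologicalSpace K] :
    Tendsto (fun n => ∑ k ∈ Finset.range (2 * n + 1), (X : K⟦X⟧) ^ (k * (k + 1) / 2)) atTop
      (𝓝 (triangularSeries K)) := by
  rw [tendsto_iff_coeff_tendsto]
  intro d
  refine tendsto_nhds_of_eventually_eq ?_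
  filter_upwards [eventually_ge_atTop d] with n hn
  simp only [map_sum, coeff_X_pow, triangularSeries, coeff_mk]
  split_ifs with h
  · obtain ⟨k, rfl⟩ := h
    have hk : k ≤ k * (k + 1) / 2 := triangular_strictMono.le_apply
    rw [Finset.sum_eq_single k]
    · simp
    · intro l _ hl
      exact if_neg fun h => hl (triangular_strictMono.injective h).symm
    · intro h
      simp at h
      omega
  · exact Finset.sum_eq_zero fun k _ => if_neg fun hk => h ⟨k, hk.symm⟩

/-- **Gauss's identity** `∑ k, q ^ (k * (k + 1) / 2) = f_2 ^ 2 / f_1`, the limit of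
`sum_triangular_eq`, in which only the term with `s = 0` survives. -/
theorem triangularSeries_mul_pentagonalSeries :
    triangularSeries K * pentagonalSeries K = expand 2 two_ne_zero (pentagonalSeries K) ^ 2 := by
  let : TopologicalSpace K := ⊥
  have : DiscreteTopology K := ⟨rfl⟩
  have hE := tendsto_evenProd K
  have hO := tendsto_oddProd_mul_evenProd K
  have hrem : Tendsto (fun n => oddProd K n * evenProd K n * ∑ s ∈ Finset.range n,
      evenOddQuotient K n * (evenOddQuotient K (s + 1))⁻¹ * X ^ ((s + 1) * (2 * n + 1))) atTop
      (𝓝 0) := by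
    rw [tendsto_iff_coeff_tendsto]
    intro d
    refine tendsto_nhds_of_eventually_eq ?_
    filter_upwards [eventually_ge_atTop d] with n hn
    rw [Finset.mul_sum, map_sum, map_zero]
    refine Finset.sum_eq_zero fun s _ => ?_
    rw [← mul_assoc, coeff_mul_X_pow', if_neg (by nlinarith)]
  have h := ((hE.pow 2).add hrem)
  rw [add_zero] at h
  refine tendsto_nhds_unique ((tendsto_sum_triangular K).mul hO) (h.congr fun n => ?_)
  have hq : oddProd K n * evenOddQuotient K n = evenProd K n := by
    have := PowerSeries.mul_inv_cancel (oddProd K n) (by simp [constantCoeff_oddProd])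
    rw [evenOddQuotient]
    linear_combination evenProd K n * this
  have h0 : (evenOddQuotient K 0)⁻¹ = 1 := by simp [evenOddQuotient, evenProd, oddProd]
  rw [sum_triangular_eq, Finset.sum_range_succ', h0]
  linear_combination -evenProd K n * hq

end Gauss

/-! ### Vanishing coefficients -/

theorem expand_three_eq_pow (f : (ZMod 3)⟦X⟧) : expand 3 three_ne_zero f = f ^ 3 := by
  have := Fact.mk Nat.prime_three
  have h := MvPowerSeries.map_frobenius_expand (σ := Unit) (R := ZMod 3) 3 three_ne_zero (f := f)
  rw [ZMod.frobenius_zmod] at h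
  rw [← h]
  simp
  rfl

/-- If `3` divides `k * (k + 1) / 2`, then `k = 3 * l` or `k = 3 * l + 2`; these yield the
generalized pentagonal numbers with index `-l` and `l + 1`. -/
theorem triangular_eq_three_mul_pentagonal_iff (n : ℕ) :
    (∃ k, k * (k + 1) / 2 = 3 * n) ↔ n ∈ Set.range pentagonal := by
  constructor
  · rintro ⟨k, hk⟩
    have h2 : k * (k + 1) = 6 * n := by
      have := Nat.two_mul_div_two_of_even (Nat.even_mul_succ_self k)
      omega
    have hmod : k % 3 = 0 ∨ k % 3 = 2 := by
      have h3 : k * (k + 1) % 3 = 0 := by omega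
      have : k % 3 < 3 := Nat.mod_lt _ (by norm_num)
      rw [Nat.mul_mod, Nat.add_mod] at h3
      interval_cases k % 3 <;> simp_all
    rcases hmod with h | h
    · obtain ⟨l, rfl⟩ : ∃ l, k = 3 * l := ⟨k / 3, by omega⟩
      refine ⟨-l, ?_⟩
      have := two_mul_natCast_pentagonal (-(l : ℤ))
      zify at h2 ⊢
      linarith
    · obtain ⟨l, rfl⟩ : ∃ l, k = 3 * l + 2 := ⟨k / 3, by omega⟩
      refine ⟨l + 1, ?_⟩
      have := two_mul_natCast_pentagonal ((l : ℤ) + 1)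
      zify at h2 ⊢
      linarith
  · rintro ⟨m, rfl⟩
    have := two_mul_natCast_pentagonal m
    obtain ⟨k, hk⟩ : ∃ k : ℕ, (k : ℤ) * (k + 1) = 3 * (m * (3 * m - 1)) := by
      rcases le_or_gt m 0 with h | h
      · refine ⟨(-3 * m).toNat, ?_⟩
        rw [Int.toNat_of_nonneg (by omega)]
        ring
      · refine ⟨(3 * m - 1).toNat, ?_⟩
        rw [Int.toNat_of_nonneg (by omega)]
        ring
    refine ⟨k, ?_⟩
    have : k * (k + 1) = 2 * (3 * pentagonal m) := by
      zify
      linarith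
    rw [this]
    simp

/-- Sign-reversing involution on the representations of `3 * n + 2` by
`2 * pentagonal u + pentagonal v`. In terms of `a = 6 * v - 1` and `b = 6 * u - 1`, it is `c ↦ -c`
where `a + b * √-2 = (c + d * √-2) * (1 + √-2)`. -/
theorem sum_negOnePow_eq_zero (R : Type*) [CommRing R] (n : ℕ) (S : Finset (ℤ × ℤ))
    (hS : ∀ p, p ∈ S ↔ 2 * pentagonal p.1 + pentagonal p.2 = 3 * n + 2) :
    ∑ p ∈ S, ((Int.negOnePow p.1 : ℤ) : R) = 0 := by
  have hS' : ∀ u v : ℤ, (u, v) ∈ S ↔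
      2 * (u * (3 * u - 1)) + v * (3 * v - 1) = 2 * (3 * n + 2) := by
    intro u v
    have hu := two_mul_natCast_pentagonal u
    have hv := two_mul_natCast_pentagonal v
    rw [hS]
    zify
    constructor <;> intro h <;> linarith
  have hpar : ∀ u v : ℤ, (u, v) ∈ S → ∃ t, v = u + 2 + 3 * t := by
    intro u v h
    rw [hS'] at h
    -- The linear terms of the equation give `v = u + 2` modulo `3`.
    refine ⟨2 * u ^ 2 + v ^ 2 - 2 * n - 2 - u, ?_⟩
    linarith
  refine Finset.sum_involution
    (fun p _ => ((1 - p.1 - 2 * p.2) / 3, (p.2 - 4 * p.1 + 1) / 3)) ?_ ?_ ?_ ?_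
  all_goals
    rintro ⟨u, v⟩ h
    obtain ⟨t, rfl⟩ := hpar u v h
    have e1 : (1 - u - 2 * (u + 2 + 3 * t)) / 3 = -u - 1 - 2 * t := by omega
    have e2 : (u + 2 + 3 * t - 4 * u + 1) / 3 = 1 - u + t := by omega
    simp only [e1, e2]
  · have : -u - 1 - 2 * t = u + (2 * (-u - t) - 1) := by ring
    rw [this, Int.negOnePow_add, Int.negOnePow_odd (2 * (-u - t) - 1) (by grind)]
    simp
  · intro _ he
    simp at he
    omega
  · rw [hS'] at h ⊢
    linarith
  · ext <;> simp <;> omega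

/-- The coefficients of `f_6 * ψ` vanish at all exponents congruent to `6` modulo `9`. -/
theorem coeff_expand_six_mul_triangularSeries (K : Type*) [Field K] (n : ℕ) :
    coeff (9 * n + 6) (expand 6 (by norm_num) (pentagonalSeries K) * triangularSeries K) = 0 := by
  classical
  set φ : ℤ × ℤ → ℕ × ℕ := fun p => (6 * pentagonal p.1, 3 * pentagonal p.2) with hφ
  have hinj : Function.Injective φ := by
    rintro ⟨a, b⟩ ⟨c, d⟩ h
    simpa [hφ, pentagonal_inj] using h
  rw [coeff_mul, ← Finset.sum_preimage φ _ hinj.injOn]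
  · rw [← sum_negOnePow_eq_zero K n
      ((Finset.HasAntidiagonal.antidiagonal (9 * n + 6)).preimage φ hinj.injOn)]
    · refine Finset.sum_congr rfl fun p _ => ?_
      rw [coeff_expand_mul, coeff_pentagonalSeries_pentagonal, triangularSeries, coeff_mk, if_pos,
        mul_one]
      rw [triangular_eq_three_mul_pentagonal_iff]
      exact ⟨_, rfl⟩
    · rintro ⟨u, v⟩
      simp [hφ]
      omega
  · rintro ⟨a, b⟩ hab hnot
    rw [Finset.HasAntidiagonal.mem_antidiagonal] at hab
    simp only at hab ⊢
    by_contra hne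
    have ha := left_ne_zero_of_mul hne
    have hb := right_ne_zero_of_mul hne
    rw [coeff_expand] at ha
    split_ifs at ha with h6
    -- `6 ∣ a` and `a + b = 9 * n + 6` make `b` a multiple of `3`.
    · obtain ⟨a, rfl⟩ := h6
      rw [Nat.mul_div_cancel_left _ (by norm_num), Ne, coeff_pentagonalSeries_eq_zero_iff,
        not_not] at ha
      obtain ⟨u, rfl⟩ := ha
      obtain ⟨b, rfl⟩ : ∃ c, b = 3 * c := ⟨b / 3, by omega⟩
      rw [triangularSeries, coeff_mk, Ne, ite_eq_right_iff, not_forall] at hb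
      obtain ⟨hb, -⟩ := hb
      obtain ⟨v, rfl⟩ := (triangular_eq_three_mul_pentagonal_iff _).1 hb
      exact hnot ⟨(u, v), rfl⟩
    · exact ha rfl

/-- Multiplication by a power series in `X ^ p` preserves the vanishing of all coefficients whose
exponents lie in a given residue class modulo `p`. -/
theorem coeff_expand_mul_eq_zero {R : Type*} [CommRing R] {p : ℕ} (hp : p ≠ 0) {c : ℕ}
    (hc : c < p) {f : R⟦X⟧} (hf : ∀ n, coeff (p * n + c) f = 0) (g : R⟦X⟧) (n : ℕ) :
    coeff (p * n + c) (expand p hp g * f) = 0 := by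
  rw [coeff_mul]
  refine Finset.sum_eq_zero fun x hx => ?_
  rw [Finset.HasAntidiagonal.mem_antidiagonal] at hx
  by_cases h : p ∣ x.1
  · obtain ⟨m, hm⟩ := h
    have hmn : m ≤ n := by
      by_contra! hlt
      have : p * (n + 1) ≤ p * m := Nat.mul_le_mul_left _ hlt
      rw [mul_add_one] at this
      omega
    obtain ⟨l, rfl⟩ := Nat.exists_eq_add_of_le hmn
    rw [show x.2 = p * l + c by rw [hm, mul_add] at hx; omega, hf, mul_zero]
  · rw [coeff_expand_of_not_dvd p hp _ h, zero_mul]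

/-! ### The congruence -/

theorem theorem1p12 (n k j : ℕ) (hjk : j ≤ k) :
    coloredPartitionCount (9 * (k - j) + 5) (9 * k + 1) (9 * n + 6) ≡ 0 [MOD 3] := by
  have := Fact.mk Nat.prime_three
  obtain ⟨i, rfl⟩ := Nat.exists_eq_add_of_le hjk
  rw [Nat.add_sub_cancel_left, ← ZMod.natCast_eq_natCast_iff, Nat.cast_zero]
  have hG := mk_coloredPartitionCount_mul (ZMod 3) (9 * i + 5) (9 * (j + i) + 1)
  have hψ := triangularSeries_mul_pentagonalSeries (ZMod 3)
  have hf := coeff_expand_six_mul_triangularSeries (ZMod 3)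
  have h6 : expand 6 (by norm_num) (pentagonalSeries (ZMod 3)) =
      expand 2 two_ne_zero (pentagonalSeries (ZMod 3)) ^ 3 := by
    rw [← expand_three_eq_pow, ← expand_mul]
  have h9 (f : (ZMod 3)⟦X⟧) : expand 9 (by norm_num) f = f ^ 9 := by
    rw [show f ^ 9 = (f ^ 3) ^ 3 by ring, ← expand_three_eq_pow, ← expand_three_eq_pow,
      ← expand_mul]
  have hE1 : constantCoeff (pentagonalSeries (ZMod 3)) = 1 := by
    have := coeff_pentagonalSeries_pentagonal (ZMod 3) 0
    simpa [pentagonal_def] using this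
  have hE2 : constantCoeff (expand 2 two_ne_zero (pentagonalSeries (ZMod 3))) = 1 := by
    rw [constantCoeff_expand, hE1]
  rw [h6] at hf
  set E1 := pentagonalSeries (ZMod 3)
  set E2 := expand 2 two_ne_zero E1
  set ψ := triangularSeries (ZMod 3)
  set G := PowerSeries.mk fun n =>
    (coloredPartitionCount (9 * i + 5) (9 * (j + i) + 1) n : ZMod 3) with hGdef
  have hE1' : E1 ≠ 0 := fun h => by simp [h] at hE1
  have hE2' : E2 ≠ 0 := fun h => by simp [h] at hE2
  -- The factors of the generating function that occur to a ninth power are collected in `W ^ 9` on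
  -- the left and in `(E2 ^ j) ^ 9` on the right.
  set W := E1 ^ (j + i) * E2
  have hW : W ^ 9 * (W⁻¹) ^ 9 = 1 := by
    rw [← mul_pow, PowerSeries.mul_inv_cancel _ (by simp [W, hE1, hE2]), one_pow]
  have hWG : W ^ 9 * G = (E2 ^ j) ^ 9 * (E2 ^ 3 * ψ) := by
    refine mul_right_cancel₀ (mul_ne_zero hE1' (pow_ne_zero (9 * i) hE2')) ?_
    linear_combination E2 ^ 4 * hG - E2 ^ (9 * j + 9 * i + 3) * hψ
  have hGeq : G = expand 9 (by norm_num) (W⁻¹ * E2 ^ j) * (E2 ^ 3 * ψ) := by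
    rw [h9]
    linear_combination W⁻¹ ^ 9 * hWG - G * hW
  rw [← coeff_mk (9 * n + 6)
    (fun n => (coloredPartitionCount (9 * i + 5) (9 * (j + i) + 1) n : ZMod 3)), ← hGdef, hGeq]
  exact coeff_expand_mul_eq_zero _ (by norm_num) hf _ n
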